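/- Let $\mathcal M$ be a compact metric space with its Borel $\sigma$-field, let $d\ge 0$ be an integer, and let $K\ge 0$ and $R\ge 1$ be real. A dissimilarity function is a function $\Delta:\mathcal M\times\mathcal M\to[0,\infty)$ that is symmetric and zero on the diagonal. A $d$-dimensional Euclidean pseudometric is a function $D(m_1,m_2)=\|f(m_1)-f(m_2)\|$ with $f:\mathcal M\to\mathbb R^d$ Borel-measurable (an embedding function of $D$). For a dissimilarity function $\Delta$ and a Borel probability measure $P$ on $\mathcal M$, let $\Omega_K(\Delta,P)$ be the set of $d$-dimensional Euclidean pseudometrics $D$ with $D(m_1,m_2)\le K\Delta(m_1,m_2)$ for $P\otimes P$-almost every $(m_1,m_2)$, and let $\mathrm{Min}(\Delta,P)$ be the set of global minimizers over $D\in\Omega_K(\Delta,P)$ of the raw stress $$\sigma((\Delta,P),D)=\int\!\!\int\bigl[D(m_1,m_2)-\Delta(m_1,m_2)\bigr]^2\,P(dm_1)\,P(dm_2).$$ Let $\Delta_\infty$ be a metric on $\mathcal M$ that induces the topology of $\mathcal M$. Let $\mathcal D_R$ be the set of continuous dissimilarity functions $\Delta$ with $\frac1R\Delta_\infty(m_1,m_2)\le\Delta(m_1,m_2)\le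 R\,\Delta_\infty(m_1,m_2)$ for all $m_1\ne m_2$, metrized by $$\mu(\Delta_1,\Delta_2)=\log\inf\Bigl\{r\ge 1:\tfrac1r\le\tfrac{\Delta_1(m_1,m_2)}{\Delta_2(m_1,m_2)}\le r\ \text{for all } m_1\neq m_2\Bigr\}.$$ **Theorem.** Let $P_\infty$ be a Borel probability measure on $\mathcal M$. For $n=1,2,\dots$ let $\Delta_n\in\mathcal D_R$ with $\mu(\Delta_n,\Delta_\infty)\to0$, and let $\hat P_n$ be the empirical measure of $n$ points (not necessarily distinct) of the support of $P_\infty$, such that $\hat P_n\to P_\infty$ weakly. Then for every sequence $D_n\in\mathrm{Min}(\Delta_n,\hat P_n)$ there is a sequence $\bar D_n:\mathcal M\times\mathcal M\to\mathbb R$ such that: (a) $\bar D_n(m_1,m_2)=D_n(m_1,m_2)$ for all $n$ and all $m_1,m_2$ in the support of $\hat P_n$; (b) $\bar D_n\in\mathrm{Min}(\Delta_n,\hat P_n)$ for all $n$; (c) $\{\bar D_n\}$ has an accumulation point in the topology of uniform convergence on $\mathcal M\times\mathcal M$; (d) every accumulation point of $\{\bar D_n\}$ in the topology of uniform convergence lies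 in $\mathrm{Min}(\Delta_\infty,P_\infty)$; (e) there are embedding functions $f_n$ of $D_n$ and maps $F_n:\mathcal M\to\mathbb R^d$ with $\bar D_n(m_1,m_2)=\|F_n(m_1)-F_n(m_2)\|$ such that $F_n=f_n$ on the support of $\hat P_n$ and each coordinate of $F_n$ is Lipschitz on $\mathcal M$ with respect to $\Delta_\infty$ with constant $KR$; (f) the $\bar D_n$ are uniformly bounded, and, for all $n$ and all $m_1,m_2,m_1',m_2'\in\mathcal M$, $$|\bar D_n(m_1,m_2)-\bar D_n(m_1',m_2')|\le KR\sqrt{3d}\,\bigl[\Delta_\infty(m_1,m_1')^2+\Delta_\infty(m_2,m_2')^2\bigr]^{1/2}.$$ -/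

import Mathlib

open MeasureTheory Filter Topology
open scoped ENNReal

namespace ContinuousMDS

/-- A dissimilarity function: zero on the diagonal, nonnegative, symmetric. -/
structure IsDissimilarity {M : Type*} (Δ : M → M → ℝ) : Prop where
  self_eq_zero : ∀ x, Δ x x = 0
  nonneg : ∀ x y, 0 ≤ Δ x y
  symm : ∀ x y, Δ x y = Δ y x

/-- `Δ` metrizes the topological space `M`: it is a metric on `M` (a dissimilarity function that
separates points and satisfies the triangle inequality) whose metric topology is the topology
of `M`. -/
structure Metrizes {M : Type*} [TopologicalSpace M] (Δ : M → M → ℝ) : Prop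
    extends IsDissimilarity Δ where
  eq_of_eq_zero : ∀ x y, Δ x y = 0 → x = y
  triangle : ∀ x y z, Δ x z ≤ Δ x y + Δ y z
  isOpen_iff : ∀ s : Set M, IsOpen s ↔ ∀ x ∈ s, ∃ ε > 0, ∀ y, Δ x y < ε → y ∈ s

/-- The class `𝒟_R` of continuous dissimilarity functions `Δ` with
`Δinf / R ≤ Δ ≤ R Δinf` off the diagonal. -/
def ratioClass {M : Type*} [TopologicalSpace M] (Δinf : M → M → ℝ) (R : ℝ) :
    Set (M → M → ℝ) :=
  {Δ | IsDissimilarity Δ ∧ Continuous (fun z : M × M => Δ z.1 z.2) ∧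
    ∀ x y, x ≠ y → 1 / R * Δinf x y ≤ Δ x y ∧ Δ x y ≤ R * Δinf x y}

/-- The metric `μ` on `𝒟_R`,
`μ(Δ₁, Δ₂) = log inf {r : 1 / r ≤ Δ₁ x y / Δ₂ x y ≤ r for all x ≠ y}`.
As soon as `M` has two points every such `r` is at least `1`; writing `1 ≤ r` explicitly
makes the value `log 1 = 0` when `M` has only one point. -/
noncomputable def ratioDist {M : Type*} (Δ₁ Δ₂ : M → M → ℝ) : ℝ :=
  Real.log (sInf {r : ℝ | 1 ≤ r ∧
    ∀ x y, x ≠ y → 1 / r ≤ Δ₁ x y / Δ₂ x y ∧ Δ₁ x y / Δ₂ x y ≤ r})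

/-- The empirical probability measure of `N ≥ 1` points (listed with repetition). -/
noncomputable def empirical {M : Type*} [MeasurableSpace M] {N : ℕ} [NeZero N]
    (x : Fin N → M) : ProbabilityMeasure M :=
  ⟨(N : ℝ≥0∞)⁻¹ • ∑ i, Measure.dirac (x i), ⟨by
    simp [ENNReal.inv_mul_cancel (Nat.cast_ne_zero.mpr (NeZero.ne N))
      (ENNReal.natCast_ne_top N)]⟩⟩

/-- `D` is the pseudometric `(x, y) ↦ ‖f x - f y‖` of the embedding function `f : M → ℝ^d`. -/
def Represents {M : Type*} {d : ℕ} (f : M → EuclideanSpace ℝ (Fin d)) (D : M → M → ℝ) : Prop :=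
  ∀ x y, D x y = ‖f x - f y‖

/-- The cone `𝒴` of `d`-dimensional Euclidean pseudometrics: those of the Borel-measurable
embedding functions `M → ℝ^d`. -/
def euclideanPseudometrics (M : Type*) [MeasurableSpace M] (d : ℕ) : Set (M → M → ℝ) :=
  {D | ∃ f : M → EuclideanSpace ℝ (Fin d), Measurable f ∧ Represents f D}

/-- The continuous raw stress criterion
`σ((Δ, P), D) = ∫∫ (D x y - Δ x y)² P(dx) P(dy)`, with values in `[0, ∞]`. -/
noncomputable def rawStress {M : Type*} [MeasurableSpace M] (Δ : M → M → ℝ)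
    (P : ProbabilityMeasure M) (D : M → M → ℝ) : ℝ≥0∞ :=
  ∫⁻ y, ∫⁻ x, ENNReal.ofReal ((D x y - Δ x y) ^ 2) ∂(P : Measure M) ∂(P : Measure M)

/-- The feasible set `Ω_K(Δ, P)`: Euclidean pseudometrics that satisfy the approximate Lipschitz
constraints `D x y ≤ K Δ x y` with probability one, `x` and `y` being drawn independently
from `P`. -/
def feasible {M : Type*} [MeasurableSpace M] (d : ℕ) (K : ℝ) (Δ : M → M → ℝ)
    (P : ProbabilityMeasure M) : Set (M → M → ℝ) :=
  {D | D ∈ euclideanPseudometrics M d ∧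
    ∀ᵐ z ∂((P : Measure M).prod (P : Measure M)), D z.1 z.2 ≤ K * Δ z.1 z.2}

/-- `Min(Δ, P)`: the global minimizers of the raw stress over `Ω_K(Δ, P)`. -/
def minimizers {M : Type*} [MeasurableSpace M] (d : ℕ) (K : ℝ) (Δ : M → M → ℝ)
    (P : ProbabilityMeasure M) : Set (M → M → ℝ) :=
  {D | D ∈ feasible d K Δ P ∧ ∀ D' ∈ feasible d K Δ P, rawStress Δ P D ≤ rawStress Δ P D'}

/-- `D` is an accumulation point of the sequence `Dseq` in the topology of uniform convergence
on `M × M`: some subsequence converges uniformly to `D`. -/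
def IsUniformAccumulationPoint {M : Type*} (Dseq : ℕ → M → M → ℝ) (D : M → M → ℝ) : Prop :=
  ∃ φ : ℕ → ℕ, StrictMono φ ∧
    TendstoUniformly (fun k (z : M × M) => Dseq (φ k) z.1 z.2) (fun z => D z.1 z.2) atTop

end ContinuousMDS

open ContinuousMDS

/-! Every pair of sample points has positive mass, so the almost sure constraint for `D n` holds at
all such pairs and makes `f n` Lipschitz there with constant `K * R` for `Δinf`. McShane extension
of each coordinate gives `F n`; feasibility and stress see only the sample, so the new pseudometric
is still a minimizer (`minimizers_congr`). Translated to vanish at a common point, the `F n` form a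
relatively compact family by Arzelà–Ascoli.

For the limit, weak convergence together with uniform convergence carries over both constraints and
stress (`ae_le_of_tendsto`, `tendsto_rawStress`). Optimality needs competitors for the approximating
problems: a feasible pseudometric of the limiting problem has a continuous version obeying the
constraint on the whole support of `Pinf` (`exists_continuous_version`). The samples lie in that
support, so shrinking this version by a ratio tending to 1 makes it feasible for each approximating
problem. Comparing stresses and passing to the limit gives the claim. -/

namespace ContinuousMDS

/-! ### Lipschitz extension and compactness for a metrizing dissimilarity. -/

section Metrizes

variable {M : Type*} [TopologicalSpace M] {Δ : M → M → ℝ}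

lemma Metrizes.abs_sub_le (h : Metrizes Δ) (x y x' y' : M) :
    |Δ x y - Δ x' y'| ≤ Δ x x' + Δ y y' := by
  have h1 := h.triangle x x' y
  have h2 := h.triangle x' y' y
  have h3 := h.triangle x' x y'
  have h4 := h.triangle x y y'
  have h5 := h.symm x x'
  have h6 := h.symm y y'
  rw [abs_le]
  constructor <;> linarith

lemma Metrizes.eventually_lt (h : Metrizes Δ) (x : M) {ε : ℝ} (hε : 0 < ε) :
    ∀ᶠ y in 𝓝 x, Δ x y < ε := by
  have hopen : IsOpen {y | Δ x y < ε} := (h.isOpen_iff _).2 fun y hy =>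
    ⟨ε - Δ x y, sub_pos.2 hy, fun z hz => by
      have := h.triangle x y z
      simp only [Set.mem_ofPred_eq]
      linarith⟩
  exact hopen.mem_nhds (by simpa [h.self_eq_zero x] using hε)

lemma Metrizes.continuous (h : Metrizes Δ) : Continuous fun z : M × M => Δ z.1 z.2 := by
  rw [continuous_iff_continuousAt]
  rintro ⟨x, y⟩
  rw [Metric.continuousAt_iff']
  intro ε hε
  rw [nhds_prod_eq]
  filter_upwards [(h.eventually_lt x (half_pos hε)).prod_mk (h.eventually_lt y (half_pos hε))]
    with z hz
  rw [dist_comm, Real.dist_eq]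
  have := h.abs_sub_le x y z.1 z.2
  linarith [hz.1, hz.2]

/-- A function that is Lipschitz with respect to `Δ` on a set extends to the whole space with
the same constant. -/
lemma Metrizes.exists_lipschitz_extension (h : Metrizes Δ) {c : ℝ} (hc : 0 ≤ c) {s : Set M}
    {f : M → ℝ} (hf : ∀ x ∈ s, ∀ y ∈ s, |f x - f y| ≤ c * Δ x y) :
    ∃ g : M → ℝ, (∀ x ∈ s, g x = f x) ∧ ∀ x y, |g x - g y| ≤ c * Δ x y := by
  -- McShane extension is purely metric: this structure need not be compared with the given
  -- topology.
  let : PseudoMetricSpace M :=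
    { dist := Δ
      dist_self := h.self_eq_zero
      dist_comm := h.symm
      dist_triangle := h.triangle }
  have hlip : LipschitzOnWith ⟨c, hc⟩ f s := LipschitzOnWith.of_dist_le_mul hf
  obtain ⟨g, hg, hgs⟩ := hlip.extend_real
  exact ⟨g, fun x hx => (hgs hx).symm, fun x y => hg.dist_le_mul x y⟩

/-- The coordinatewise extension of a map to a Euclidean space. -/
lemma Metrizes.exists_coordinatewise_extension (h : Metrizes Δ) {d : ℕ} {c : ℝ} (hc : 0 ≤ c)
    {s : Set M} {f : M → EuclideanSpace ℝ (Fin d)}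
    (hf : ∀ x ∈ s, ∀ y ∈ s, ‖f x - f y‖ ≤ c * Δ x y) :
    ∃ g : M → EuclideanSpace ℝ (Fin d), (∀ x ∈ s, g x = f x) ∧
      ∀ j x y, |g x j - g y j| ≤ c * Δ x y := by
  have hcoord (j : Fin d) : ∃ g : M → ℝ, (∀ x ∈ s, g x = f x j) ∧
      ∀ x y, |g x - g y| ≤ c * Δ x y :=
    h.exists_lipschitz_extension hc fun x hx y hy =>
      (PiLp.norm_apply_le (f x - f y) j).trans (hf x hx y hy)
  choose g hgs hg using hcoord
  refine ⟨fun x => WithLp.toLp 2 fun j => g j x, fun x hx => ?_, fun j x y => hg j x y⟩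
  ext j
  exact hgs j x hx

/-- Source of the factor `√d`: extending coordinate by coordinate keeps the constant only in each
coordinate. -/
lemma norm_sub_le_of_coordinatewise {d : ℕ} {a : ℝ} (ha : 0 ≤ a)
    {u v : EuclideanSpace ℝ (Fin d)} (huv : ∀ j, |u j - v j| ≤ a) : ‖u - v‖ ≤ √d * a := by
  rw [EuclideanSpace.norm_eq]
  calc √(∑ j, ‖(u - v) j‖ ^ 2) ≤ √(∑ _j : Fin d, a ^ 2) := by
        gcongr with j
        exact huv j
    _ = √d * a := by
        rw [Finset.sum_const, Finset.card_univ, Fintype.card_fin, nsmul_eq_mul,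
          Real.sqrt_mul (Nat.cast_nonneg d), Real.sqrt_sq ha]

lemma Metrizes.continuous_of_norm_sub_le (h : Metrizes Δ) {E : Type*} [NormedAddCommGroup E]
    {c : ℝ} {f : M → E} (hf : ∀ x y, ‖f x - f y‖ ≤ c * Δ x y) : Continuous f := by
  rw [continuous_iff_continuousAt]
  intro x
  rw [ContinuousAt, tendsto_iff_norm_sub_tendsto_zero]
  have hlim : Tendsto (fun y => c * Δ y x) (𝓝 x) (𝓝 0) := by
    have : Continuous fun y => c * Δ y x :=
      continuous_const.mul (h.continuous.comp (continuous_id.prodMk continuous_const))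
    simpa [h.self_eq_zero x] using this.tendsto x
  exact squeeze_zero (fun _ => norm_nonneg _) (fun y => hf y x) hlim

lemma Metrizes.exists_bound [CompactSpace M] (h : Metrizes Δ) :
    ∃ B, ∀ x y, Δ x y ≤ B := by
  obtain ⟨B, hB⟩ := (isCompact_range h.continuous).bddAbove
  exact ⟨B, fun x y => hB ⟨(x, y), rfl⟩⟩

/-- A sequence of maps to a Euclidean space that are uniformly Lipschitz with respect to `Δ` and
agree at some point has a subsequence that converges uniformly. -/
lemma Metrizes.exists_tendsto_subseq [CompactSpace M] (h : Metrizes Δ) {d : ℕ} {c : ℝ}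
    (m₀ : M) (G : ℕ → C(M, EuclideanSpace ℝ (Fin d))) (hG₀ : ∀ n, G n m₀ = 0)
    (hG : ∀ n x y, ‖G n x - G n y‖ ≤ c * Δ x y) :
    ∃ (G' : C(M, EuclideanSpace ℝ (Fin d))) (φ : ℕ → ℕ), StrictMono φ ∧
      Tendsto (fun k => G (φ k)) atTop (𝓝 G') := by
  let e := ContinuousMap.isometryEquivBoundedOfCompact M (EuclideanSpace ℝ (Fin d))
  obtain ⟨B, hB⟩ := (isCompact_range (continuous_const.mul h.continuous :
    Continuous fun z : M × M => c * Δ z.1 z.2)).bddAbove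
  have hcpt : IsCompact (closure (Set.range fun n => e (G n))) := by
    -- Vanishing at `m₀` confines all values to one closed ball, compact in finite dimension.
    refine BoundedContinuousFunction.arzela_ascoli (Metric.closedBall 0 B)
      (isCompact_closedBall _ _) _ ?_ ?_
    · rintro _ x ⟨n, rfl⟩
      rw [mem_closedBall_zero_iff]
      have := hG n x m₀
      rw [hG₀, sub_zero] at this
      exact this.trans (hB ⟨(x, m₀), rfl⟩)
    · intro x
      rw [Metric.equicontinuousAt_iff_right]
      intro ε hε
      have hlim : Tendsto (fun y => c * Δ x y) (𝓝 x) (𝓝 0) := by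
        have : Continuous fun y => c * Δ x y :=
          continuous_const.mul (h.continuous.comp (continuous_const.prodMk continuous_id))
        simpa [h.self_eq_zero x] using this.tendsto x
      filter_upwards [hlim.eventually_lt_const hε] with y hy
      rintro ⟨_, n, rfl⟩
      rw [dist_eq_norm]
      exact (hG n x y).trans_lt hy
  obtain ⟨g, -, φ, hφ, hlim⟩ := hcpt.tendsto_subseq
    (x := fun n => e (G n)) fun n => subset_closure ⟨n, rfl⟩
  refine ⟨e.symm g, φ, hφ, ?_⟩
  simpa [Function.comp_def] using (e.symm.continuous.tendsto g).comp hlim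

end Metrizes

/-! ### Convergence of ratios. -/

section RatioClass

variable {M : Type*} [TopologicalSpace M] {Δinf : M → M → ℝ}

lemma le_mul_of_mem_ratioClass (h : Metrizes Δinf) {R : ℝ} {Δ : M → M → ℝ}
    (hΔ : Δ ∈ ratioClass Δinf R) (x y : M) : Δ x y ≤ R * Δinf x y := by
  rcases eq_or_ne x y with rfl | hxy
  · simp [hΔ.1.self_eq_zero, h.self_eq_zero]
  · exact (hΔ.2.2 x y hxy).2

lemma Metrizes.pos (h : Metrizes Δinf) {x y : M} (hxy : x ≠ y) : 0 < Δinf x y :=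
  (h.nonneg x y).lt_of_ne fun h0 => hxy (h.eq_of_eq_zero x y h0.symm)

/-- Convergence to `Δinf` for `ratioDist` gives two-sided bounds with ratios tending to `1`. -/
lemma exists_ratio_tendsto_one (h : Metrizes Δinf) {R : ℝ} (hR : 1 ≤ R) {Δ : ℕ → M → M → ℝ}
    (hΔ : ∀ n, Δ n ∈ ratioClass Δinf R)
    (hlim : Tendsto (fun n => ratioDist (Δ n) Δinf) atTop (𝓝 0)) :
    ∃ r : ℕ → ℝ, (∀ n, 1 ≤ r n) ∧ Tendsto r atTop (𝓝 1) ∧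
      ∀ n x y, (r n)⁻¹ * Δinf x y ≤ Δ n x y ∧ Δ n x y ≤ r n * Δinf x y := by
  let S (n : ℕ) : Set ℝ := {r : ℝ | 1 ≤ r ∧
    ∀ x y, x ≠ y → 1 / r ≤ Δ n x y / Δinf x y ∧ Δ n x y / Δinf x y ≤ r}
  have hne (n : ℕ) : (S n).Nonempty := ⟨R, hR, fun x y hxy => by
    obtain ⟨h1, h2⟩ := (hΔ n).2.2 x y hxy
    exact ⟨(le_div_iff₀ (h.pos hxy)).2 h1, (div_le_iff₀ (h.pos hxy)).2 h2⟩⟩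
  have hone (n : ℕ) : 1 ≤ sInf (S n) := le_csInf (hne n) fun _ hr => hr.1
  have hsInf : Tendsto (fun n => sInf (S n)) atTop (𝓝 1) := by
    have hexp := (Real.continuous_exp.tendsto 0).comp hlim
    rw [Real.exp_zero] at hexp
    exact hexp.congr fun n => Real.exp_log (zero_lt_one.trans_le (hone n))
  -- An admissible ratio within `1 / (n + 1)` of the infimum suffices, so attainment is not needed.
  have hex (n : ℕ) : ∃ r ∈ S n, r < sInf (S n) + 1 / ((n : ℝ) + 1) :=
    exists_lt_of_csInf_lt (hne n) (lt_add_of_pos_right _ (by positivity))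
  choose r hrS hrlt using hex
  refine ⟨r, fun n => (hrS n).1, ?_, fun n x y => ?_⟩
  · refine tendsto_of_tendsto_of_tendsto_of_le_of_le tendsto_const_nhds
      (by simpa using hsInf.add tendsto_one_div_add_atTop_nhds_zero_nat)
      (fun n => (hrS n).1) (fun n => (hrlt n).le)
  · rcases eq_or_ne x y with rfl | hxy
    · simp [(hΔ n).1.self_eq_zero, h.self_eq_zero]
    · obtain ⟨h1, h2⟩ := (hrS n).2 x y hxy
      rw [le_div_iff₀ (h.pos hxy), one_div] at h1
      exact ⟨h1, (div_le_iff₀ (h.pos hxy)).1 h2⟩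

end RatioClass

end ContinuousMDS
namespace ContinuousMDS

/-! ### Stress and constraints under weak convergence. -/

section Integrals

/-- Joint continuity of the integral in a continuous function and a probability measure. -/
lemma tendsto_integral_of_tendsto {X : Type*} [TopologicalSpace X] [CompactSpace X]
    [MeasurableSpace X] [OpensMeasurableSpace X] {g : ℕ → C(X, ℝ)} {g' : C(X, ℝ)}
    (hg : Tendsto g atTop (𝓝 g')) {P : ℕ → ProbabilityMeasure X} {P' : ProbabilityMeasure X}
    (hP : Tendsto P atTop (𝓝 P')) :
    Tendsto (fun n => ∫ z, g n z ∂(P n : Measure X)) atTop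
      (𝓝 (∫ z, g' z ∂(P' : Measure X))) := by
  have hint (f : C(X, ℝ)) (Q : ProbabilityMeasure X) : Integrable f (Q : Measure X) :=
    (BoundedContinuousFunction.mkOfCompact f).integrable (Q : Measure X)
  have h1 := ProbabilityMeasure.tendsto_iff_forall_integral_tendsto.1 hP
    (BoundedContinuousFunction.mkOfCompact g')
  have h2 : Tendsto (fun n => ∫ z, (g n - g') z ∂(P n : Measure X)) atTop (𝓝 0) := by
    refine squeeze_zero_norm (fun n => ?_) (tendsto_iff_norm_sub_tendsto_zero.1 hg)
    simpa using norm_integral_le_of_norm_le_const (μ := (P n : Measure X))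
      (Eventually.of_forall fun z => (g n - g').norm_coe_le_norm z)
  have h3 := h2.add h1
  rw [zero_add] at h3
  refine h3.congr fun n => ?_
  simp only [ContinuousMap.sub_apply, BoundedContinuousFunction.mkOfCompact_apply]
  rw [integral_sub (hint _ _) (hint _ _), sub_add_cancel]

variable {M : Type*} [TopologicalSpace M] [CompactSpace M] [SecondCountableTopology M]
  [MeasurableSpace M] [BorelSpace M]

lemma rawStress_eq_ofReal_integral (A B : C(M × M, ℝ)) (P : ProbabilityMeasure M) :
    rawStress (fun x y => A (x, y)) P (fun x y => B (x, y)) =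
      ENNReal.ofReal (∫ z, ((B - A) ^ 2) z ∂(P.prod P : Measure (M × M))) := by
  have hint : Integrable ((B - A) ^ 2 : C(M × M, ℝ)) (P.prod P : Measure (M × M)) :=
    (BoundedContinuousFunction.mkOfCompact ((B - A) ^ 2)).integrable _
  rw [ofReal_integral_eq_lintegral_ofReal hint (Eventually.of_forall fun z => sq_nonneg _),
    ProbabilityMeasure.toMeasure_prod, lintegral_prod_symm]
  · rfl
  · exact (ENNReal.continuous_ofReal.comp (map_continuous _)).measurable.aemeasurable

lemma tendsto_rawStress [TopologicalSpace.PseudoMetrizableSpace M]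
    {A B : ℕ → C(M × M, ℝ)} {A' B' : C(M × M, ℝ)}
    (hA : Tendsto A atTop (𝓝 A')) (hB : Tendsto B atTop (𝓝 B'))
    {P : ℕ → ProbabilityMeasure M} {P' : ProbabilityMeasure M} (hP : Tendsto P atTop (𝓝 P')) :
    Tendsto (fun n => rawStress (fun x y => A n (x, y)) (P n) (fun x y => B n (x, y))) atTop
      (𝓝 (rawStress (fun x y => A' (x, y)) P' (fun x y => B' (x, y)))) := by
  simp only [rawStress_eq_ofReal_integral]
  exact (ENNReal.continuous_ofReal.tendsto _).comp (tendsto_integral_of_tendsto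
    ((hB.sub hA).pow 2)
    ((ProbabilityMeasure.continuous_prod.tendsto (P', P')).comp (hP.prodMk_nhds hP)))

/-- Constraints that hold almost everywhere are stable under uniform convergence of the functions
and weak convergence of the measures. -/
lemma ae_le_of_tendsto [TopologicalSpace.PseudoMetrizableSpace M]
    {A B : ℕ → C(M × M, ℝ)} {A' B' : C(M × M, ℝ)}
    (hA : Tendsto A atTop (𝓝 A')) (hB : Tendsto B atTop (𝓝 B'))
    {P : ℕ → ProbabilityMeasure M} {P' : ProbabilityMeasure M} (hP : Tendsto P atTop (𝓝 P'))
    (h : ∀ n, ∀ᵐ z ∂((P n : Measure M).prod (P n : Measure M)), B n z ≤ A n z) :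
    ∀ᵐ z ∂((P' : Measure M).prod (P' : Measure M)), B' z ≤ A' z := by
  -- The constraint says that the integral of the positive part of `B - A` vanishes, a condition
  -- closed under the joint limit.
  let pos : C(ℝ, ℝ) := ⟨fun t => max t 0, by fun_prop⟩
  have hlim := tendsto_integral_of_tendsto
    (((ContinuousMap.continuous_postcomp pos).tendsto (B' - A')).comp (hB.sub hA))
    ((ProbabilityMeasure.continuous_prod.tendsto (P', P')).comp (hP.prodMk_nhds hP))
  have hzero : ∫ z, pos.comp (B' - A') z ∂(P'.prod P' : Measure (M × M)) = 0 := by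
    refine tendsto_nhds_unique hlim (tendsto_const_nhds.congr fun n => ?_)
    refine (integral_eq_zero_of_ae ?_).symm
    filter_upwards [h n] with z hz
    exact max_eq_right (sub_nonpos.2 hz)
  have hnonneg : 0 ≤ ⇑(pos.comp (B' - A')) := fun z => le_max_right _ _
  filter_upwards [(integral_eq_zero_iff_of_nonneg hnonneg
    ((BoundedContinuousFunction.mkOfCompact (pos.comp (B' - A'))).integrable _)).1 hzero] with z hz
  exact sub_nonpos.1 (max_eq_right_iff.1 hz)

end Integrals

/-! ### Null sets and empirical measures. -/

section Congruence

variable {M : Type*} [MeasurableSpace M] {P : ProbabilityMeasure M} {A : Set M}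

lemma rawStress_congr (hA : A ∈ ae (P : Measure M)) {D D' : M → M → ℝ}
    (h : ∀ x ∈ A, ∀ y ∈ A, D x y = D' x y) (Δ : M → M → ℝ) :
    rawStress Δ P D = rawStress Δ P D' := by
  refine lintegral_congr_ae ?_
  filter_upwards [hA] with y hy
  refine lintegral_congr_ae ?_
  filter_upwards [hA] with x hx
  rw [h x hx y hy]

lemma prod_mem_ae_prod (hA : A ∈ ae (P : Measure M)) :
    A ×ˢ A ∈ ae ((P : Measure M).prod (P : Measure M)) := by
  filter_upwards [Measure.quasiMeasurePreserving_fst.ae hA,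
    Measure.quasiMeasurePreserving_snd.ae hA] with z h1 h2
  exact ⟨h1, h2⟩

lemma ae_prod_of_forall_mem (hA : A ∈ ae (P : Measure M)) {p : M × M → Prop}
    (h : ∀ x ∈ A, ∀ y ∈ A, p (x, y)) :
    ∀ᵐ z ∂((P : Measure M).prod (P : Measure M)), p z := by
  filter_upwards [prod_mem_ae_prod hA] with z hz
  exact h _ hz.1 _ hz.2

end Congruence

section Empirical

variable {M : Type*} [MeasurableSpace M] {N : ℕ} [NeZero N]

lemma coe_empirical (x : Fin N → M) :
    (empirical x : Measure M) = (N : ℝ≥0∞)⁻¹ • ∑ i, Measure.dirac (x i) := rfl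

lemma empirical_pos [MeasurableSingletonClass M] (x : Fin N → M) (i : Fin N) :
    0 < (empirical x : Measure M) {x i} := by
  rw [coe_empirical, Measure.smul_apply, Measure.finsetSum_apply, smul_eq_mul]
  refine ENNReal.mul_pos (by simp) (ne_of_gt (lt_of_lt_of_le ?_
    (Finset.single_le_sum (fun _ _ => zero_le) (Finset.mem_univ i))))
  simp

lemma range_mem_ae_empirical [MeasurableSingletonClass M] (x : Fin N → M) :
    Set.range x ∈ ae (empirical x : Measure M) := by
  rw [mem_ae_iff, coe_empirical, Measure.smul_apply, Measure.finsetSum_apply, smul_eq_mul]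
  refine mul_eq_zero_of_right _ (Finset.sum_eq_zero fun i _ => ?_)
  simp [Measure.dirac_apply' _ (Set.finite_range x).measurableSet.compl]

lemma support_empirical_subset [TopologicalSpace M] [T1Space M] [MeasurableSingletonClass M]
    (x : Fin N → M) : (empirical x : Measure M).support ⊆ Set.range x :=
  Measure.support_subset_of_isClosed (Set.finite_range x).isClosed (range_mem_ae_empirical x)

/-- Each pair of sample points is an atom of the product measure, so no exceptional null set can
contain it. -/
lemma forall_of_ae_prod_empirical [MeasurableSingletonClass M] (x : Fin N → M)
    {p : M × M → Prop}
    (h : ∀ᵐ z ∂((empirical x : Measure M).prod (empirical x : Measure M)), p z) :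
    ∀ a ∈ Set.range x, ∀ b ∈ Set.range x, p (a, b) := by
  rintro _ ⟨i, rfl⟩ _ ⟨j, rfl⟩
  by_contra hp
  have hnull : ((empirical x : Measure M).prod (empirical x : Measure M))
      ({x i} ×ˢ {x j}) = 0 := by
    refine measure_mono_null ?_ (ae_iff.1 h)
    rintro ⟨a, b⟩ ⟨ha, hb⟩
    rw [Set.mem_singleton_iff] at ha hb
    simp only at ha hb
    subst ha hb
    exact hp
  rw [Measure.prod_prod] at hnull
  exact (ENNReal.mul_pos (empirical_pos x i).ne' (empirical_pos x j).ne').ne' hnull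

end Empirical

/-! ### From almost sure to pointwise Lipschitz bounds. -/

section LipschitzVersion

variable {M : Type*} [TopologicalSpace M] [SecondCountableTopology M] [MeasurableSpace M]
  [BorelSpace M]

/-- An almost sure Lipschitz inequality for pairs holds for all pairs in a set of full measure. -/
lemma exists_mem_ae_forall_norm_sub_le {E : Type*} [NormedAddCommGroup E]
    [SecondCountableTopology E] [MeasurableSpace E] [BorelSpace E] {P : ProbabilityMeasure M}
    {Φ : M × M → ℝ} (hΦ : Continuous Φ) {f : M → E} (hf : Measurable f)
    (h : ∀ᵐ z ∂((P : Measure M).prod (P : Measure M)), ‖f z.1 - f z.2‖ ≤ Φ z) :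
    ∃ A ∈ ae (P : Measure M), ∀ x ∈ A, ∀ y ∈ A, ‖f x - f y‖ ≤ Φ (x, y) := by
  have hgr : Measurable fun x => (x, f x) := measurable_id.prodMk hf
  -- Passing to the graph replaces continuity of `f`: violating the bound is an open condition on
  -- pairs of graph points, so a violation at two points of the support of `ν` would spread to a set
  -- of positive product measure.
  let ν : Measure (M × E) := (P : Measure M).map fun x => (x, f x)
  refine ⟨(fun x => (x, f x)) ⁻¹' ν.support, ?_, fun x hx y hy => ?_⟩
  · exact (ae_map_iff hgr.aemeasurable Measure.isClosed_support.measurableSet).1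
      (Measure.support_mem_ae (μ := ν))
  by_contra! hlt
  have hopen : IsOpen {w : (M × E) × (M × E) | Φ (w.1.1, w.2.1) < ‖w.1.2 - w.2.2‖} :=
    isOpen_lt (hΦ.comp (by fun_prop)) (by fun_prop)
  obtain ⟨U, V, hU, hV, hxU, hyV, hUV⟩ :=
    isOpen_prod_iff.1 hopen (x, f x) (y, f y) hlt
  have hUpos := (Measure.mem_support_iff_forall _).1 hx U (hU.mem_nhds hxU)
  have hVpos := (Measure.mem_support_iff_forall _).1 hy V (hV.mem_nhds hyV)
  rw [Measure.map_apply hgr hU.measurableSet] at hUpos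
  rw [Measure.map_apply hgr hV.measurableSet] at hVpos
  refine (ENNReal.mul_pos hUpos.ne' hVpos.ne').ne' ?_
  rw [← Measure.prod_prod]
  refine measure_mono_null ?_ (ae_iff.1 h)
  rintro ⟨a, b⟩ ⟨ha, hb⟩
  have hab : ((a, f a), (b, f b)) ∈ U ×ˢ V := ⟨ha, hb⟩
  exact not_le.2 (hUV hab)

end LipschitzVersion

end ContinuousMDS
namespace ContinuousMDS

/-! ### Continuous embeddings and limits of minimizers. -/

section PairDist

variable {M : Type*} [TopologicalSpace M] {E : Type*} [NormedAddCommGroup E]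

/-- The pseudometric of a continuous embedding function, as a continuous function of pairs. -/
def pairDist (G : C(M, E)) : C(M × M, ℝ) :=
  ⟨fun z => ‖G z.1 - G z.2‖, by fun_prop⟩

lemma pairDist_apply (G : C(M, E)) (x y : M) : pairDist G (x, y) = ‖G x - G y‖ := rfl

lemma continuous_pairDist : Continuous (pairDist : C(M, E) → C(M × M, ℝ)) :=
  (ContinuousMap.continuous_postcomp ⟨norm, continuous_norm⟩).comp
    ((ContinuousMap.continuous_precomp ContinuousMap.fst).sub
      (ContinuousMap.continuous_precomp ContinuousMap.snd))

lemma pairDist_mem_euclideanPseudometrics [MeasurableSpace M] [OpensMeasurableSpace M] {d : ℕ}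
    (G : C(M, EuclideanSpace ℝ (Fin d))) :
    (fun x y => pairDist G (x, y)) ∈ euclideanPseudometrics M d :=
  ⟨G, G.continuous.measurable, fun _ _ => rfl⟩

end PairDist

section Minimizers

lemma minimizers_congr {M : Type*} [MeasurableSpace M] {d : ℕ} {K : ℝ} {Δ : M → M → ℝ}
    {P : ProbabilityMeasure M} {A : Set M} (hA : A ∈ ae (P : Measure M)) {D D' : M → M → ℝ}
    (hD : D ∈ minimizers d K Δ P) (hD' : D' ∈ euclideanPseudometrics M d)
    (h : ∀ x ∈ A, ∀ y ∈ A, D' x y = D x y) : D' ∈ minimizers d K Δ P := by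
  refine ⟨⟨hD', ?_⟩, fun D'' hD'' => ?_⟩
  · filter_upwards [hD.1.2, prod_mem_ae_prod hA] with z hz hzA
    rwa [h _ hzA.1 _ hzA.2]
  · rw [rawStress_congr hA h]
    exact hD.2 D'' hD''

variable {M : Type*} [TopologicalSpace M] [SecondCountableTopology M] [MeasurableSpace M]
  [BorelSpace M] {d : ℕ}

/-- Every feasible pseudometric of the limiting problem agrees on a set of full measure with a
continuous one that satisfies the Lipschitz constraints on the whole support. -/
lemma exists_continuous_version {Δinf : M → M → ℝ} (hΔinf : Metrizes Δinf) {K : ℝ} (hK : 0 ≤ K)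
    {P : ProbabilityMeasure M} {D : M → M → ℝ} (hD : D ∈ feasible d K Δinf P) :
    ∃ g : C(M, EuclideanSpace ℝ (Fin d)),
      (∃ A ∈ ae (P : Measure M), ∀ x ∈ A, ∀ y ∈ A, D x y = pairDist g (x, y)) ∧
      ∀ x ∈ (P : Measure M).support, ∀ y ∈ (P : Measure M).support,
        ‖g x - g y‖ ≤ K * Δinf x y := by
  obtain ⟨⟨f, hf, hfD⟩, hfeas⟩ := hD
  have hcont : Continuous fun z : M × M => K * Δinf z.1 z.2 :=
    continuous_const.mul hΔinf.continuous
  obtain ⟨A, hA, hlip⟩ := exists_mem_ae_forall_norm_sub_le hcont hf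
    (hfeas.mono fun z hz => by rwa [← hfD])
  obtain ⟨g, hgA, hg⟩ := hΔinf.exists_coordinatewise_extension hK hlip
  have hgc : Continuous g := hΔinf.continuous_of_norm_sub_le (c := √d * K) fun x y => by
    rw [mul_assoc]
    exact norm_sub_le_of_coordinatewise (mul_nonneg hK (hΔinf.nonneg x y)) fun j => hg j x y
  refine ⟨⟨g, hgc⟩, ⟨A, hA, fun x hx y hy => ?_⟩, fun x hx y hy => ?_⟩
  · rw [hfD, pairDist_apply, ContinuousMap.coe_mk, hgA x hx, hgA y hy]
  · have hclosed : IsClosed {z : M × M | ‖g z.1 - g z.2‖ ≤ K * Δinf z.1 z.2} :=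
      isClosed_le (by fun_prop) hcont
    have hsub : A ×ˢ A ⊆ {z : M × M | ‖g z.1 - g z.2‖ ≤ K * Δinf z.1 z.2} := by
      rintro ⟨a, b⟩ ⟨ha, hb⟩
      change ‖g a - g b‖ ≤ K * Δinf a b
      rw [hgA a ha, hgA b hb]
      exact hlip a ha b hb
    have hsupp : (P : Measure M).support ⊆ closure A :=
      Measure.support_subset_of_isClosed isClosed_closure (mem_of_superset hA subset_closure)
    have hxy : (x, y) ∈ closure (A ×ˢ A) := by
      rw [closure_prod_eq]
      exact Set.mk_mem_prod (hsupp hx) (hsupp hy)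
    have hmem := closure_minimal hsub hclosed hxy
    rwa [Set.mem_ofPred_eq] at hmem

/-- Uniform limits of continuous embedding functions of minimizers are embedding functions of
minimizers of the limiting problem. -/
lemma pairDist_mem_minimizers_of_tendsto [CompactSpace M]
    [TopologicalSpace.PseudoMetrizableSpace M] {Δinf : M → M → ℝ} (hΔinf : Metrizes Δinf)
    {K : ℝ} (hK : 0 ≤ K) {Pinf : ProbabilityMeasure M} {P : ℕ → ProbabilityMeasure M}
    (hP : Tendsto P atTop (𝓝 Pinf)) (hsupp : ∀ n, (Pinf : Measure M).support ∈ ae (P n : Measure M))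
    {Δ : ℕ → M → M → ℝ} (hΔ : ∀ n, Continuous fun z : M × M => Δ n z.1 z.2)
    {r : ℕ → ℝ} (hr : ∀ n, 1 ≤ r n) (hr1 : Tendsto r atTop (𝓝 1))
    (hrΔ : ∀ n x y, (r n)⁻¹ * Δinf x y ≤ Δ n x y ∧ Δ n x y ≤ r n * Δinf x y)
    {G : ℕ → C(M, EuclideanSpace ℝ (Fin d))} {G' : C(M, EuclideanSpace ℝ (Fin d))}
    (hG : Tendsto G atTop (𝓝 G'))
    (hmin : ∀ n, (fun x y => pairDist (G n) (x, y)) ∈ minimizers d K (Δ n) (P n)) :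
    (fun x y => pairDist G' (x, y)) ∈ minimizers d K Δinf Pinf := by
  let A (n : ℕ) : C(M × M, ℝ) := ⟨fun z => Δ n z.1 z.2, hΔ n⟩
  let A' : C(M × M, ℝ) := ⟨fun z => Δinf z.1 z.2, hΔinf.continuous⟩
  have hrinv : Tendsto (fun n => (r n)⁻¹) atTop (𝓝 1) := by
    simpa using hr1.inv₀ one_ne_zero
  have hA : Tendsto A atTop (𝓝 A') := by
    rw [tendsto_iff_norm_sub_tendsto_zero]
    -- The common bound `r - r⁻¹` dominates both one-sided errors `r - 1` and `1 - r⁻¹`.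
    have hbound : Tendsto (fun n => (r n - (r n)⁻¹) * ‖A'‖) atTop (𝓝 0) := by
      simpa using (hr1.sub hrinv).mul_const ‖A'‖
    refine squeeze_zero (fun _ => norm_nonneg _) (fun n => ?_) hbound
    have hinv : (r n)⁻¹ ≤ 1 := inv_le_one_of_one_le₀ (hr n)
    refine (ContinuousMap.norm_le _ (mul_nonneg (by linarith [hr n]) (norm_nonneg _))).2
      fun z => ?_
    have hz := hΔinf.nonneg z.1 z.2
    have hzA : Δinf z.1 z.2 ≤ ‖A'‖ := (le_abs_self _).trans (A'.norm_coe_le_norm z)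
    obtain ⟨h1, h2⟩ := hrΔ n z.1 z.2
    have habs : |Δ n z.1 z.2 - Δinf z.1 z.2| ≤ (r n - (r n)⁻¹) * Δinf z.1 z.2 := by
      rw [abs_le]
      constructor <;> nlinarith [hr n]
    exact habs.trans (mul_le_mul_of_nonneg_left hzA (by linarith [hr n]))
  have hD := (continuous_pairDist.tendsto G').comp hG
  refine ⟨⟨pairDist_mem_euclideanPseudometrics G', ?_⟩, fun D' hD' => ?_⟩
  · exact ae_le_of_tendsto (hA.const_smul K) hD hP fun n => (hmin n).1.2
  obtain ⟨g, ⟨S, hS, hD'g⟩, hglip⟩ := exists_continuous_version hΔinf hK hD'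
  rw [rawStress_congr hS hD'g]
  -- The factor `(r n)⁻¹` turns the bound by `K * Δinf` into one by `K * Δ n`, at vanishing cost in
  -- stress.
  have hg : Tendsto (fun n => (r n)⁻¹ • g) atTop (𝓝 g) := by
    simpa using hrinv.smul_const g
  refine le_of_tendsto_of_tendsto' (tendsto_rawStress hA hD hP)
    (tendsto_rawStress hA ((continuous_pairDist.tendsto g).comp hg) hP) fun n =>
    (hmin n).2 _ ⟨pairDist_mem_euclideanPseudometrics _, ?_⟩
  refine ae_prod_of_forall_mem (hsupp n) fun x hx y hy => ?_
  have hrpos : 0 < (r n)⁻¹ := inv_pos.2 (zero_lt_one.trans_le (hr n))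
  calc ‖(r n)⁻¹ • g x - (r n)⁻¹ • g y‖ = (r n)⁻¹ * ‖g x - g y‖ := by
        rw [← smul_sub, norm_smul, Real.norm_of_nonneg hrpos.le]
    _ ≤ (r n)⁻¹ * (K * Δinf x y) := mul_le_mul_of_nonneg_left (hglip x hx y hy) hrpos.le
    _ = K * ((r n)⁻¹ * Δinf x y) := by ring
    _ ≤ K * Δ n x y := mul_le_mul_of_nonneg_left (hrΔ n x y).1 hK

end Minimizers

end ContinuousMDS

theorem mainTheorem4 {M : Type*} [MetricSpace M] [CompactSpace M] [MeasurableSpace M]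
    [BorelSpace M] (d : ℕ) (K R : ℝ) (hK : 0 ≤ K) (hR : 1 ≤ R)
    -- the limiting problem
    (Δinf : M → M → ℝ) (hΔinf : Metrizes Δinf) (Pinf : ProbabilityMeasure M)
    -- the dissimilarity functions (the term with index `n` belongs to sample size `n + 1`)
    (Δ : ℕ → M → M → ℝ) (hΔ : ∀ n, Δ n ∈ ratioClass Δinf R)
    (hΔlim : Tendsto (fun n => ratioDist (Δ n) Δinf) atTop (𝓝 0))
    -- the samples, their points lying in the support of `Pinf`, and the empirical measures
    (x : (n : ℕ) → Fin (n + 1) → M)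
    (hx : ∀ n i, x n i ∈ (Pinf : Measure M).support)
    (hPlim : Tendsto (fun n => empirical (x n)) atTop (𝓝 Pinf))
    -- the given minimizers
    (D : ℕ → M → M → ℝ) (hD : ∀ n, D n ∈ minimizers d K (Δ n) (empirical (x n))) :
    ∃ Dbar : ℕ → M → M → ℝ,
      -- agreement on the support of the empirical measure
      (∀ n, ∀ m₁ ∈ (empirical (x n) : Measure M).support,
        ∀ m₂ ∈ (empirical (x n) : Measure M).support, Dbar n m₁ m₂ = D n m₁ m₂) ∧
      -- they are still minimizers
      (∀ n, Dbar n ∈ minimizers d K (Δ n) (empirical (x n))) ∧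
      -- existence of a uniform accumulation point
      (∃ Dbarinf : M → M → ℝ, IsUniformAccumulationPoint Dbar Dbarinf) ∧
      -- every uniform accumulation point solves the limiting problem
      (∀ Dbarinf : M → M → ℝ, IsUniformAccumulationPoint Dbar Dbarinf →
        Dbarinf ∈ minimizers d K Δinf Pinf) ∧
      -- they come from coordinatewise Lipschitz extensions of the embedding functions
      (∃ f F : ℕ → M → EuclideanSpace ℝ (Fin d), ∀ n,
        Measurable (f n) ∧ Represents (f n) (D n) ∧ Represents (F n) (Dbar n) ∧
        (∀ m ∈ (empirical (x n) : Measure M).support, F n m = f n m) ∧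
        ∀ (j : Fin d) (m m' : M), |F n m j - F n m' j| ≤ K * R * Δinf m m') ∧
      -- uniform boundedness
      (∃ B : ℝ, ∀ n m₁ m₂, Dbar n m₁ m₂ ≤ B) ∧
      -- uniform Lipschitz continuity with respect to the product metric
      (∀ n m₁ m₂ m₁' m₂', |Dbar n m₁ m₂ - Dbar n m₁' m₂'| ≤
        K * R * √(3 * d) * √(Δinf m₁ m₁' ^ 2 + Δinf m₂ m₂' ^ 2)) := by

  have hKR : 0 ≤ K * R := mul_nonneg hK (zero_le_one.trans hR)
  have hfeas (n : ℕ) : ∀ a ∈ Set.range (x n), ∀ b ∈ Set.range (x n), D n a b ≤ K * R * Δinf a b :=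
    fun a ha b hb => (forall_of_ae_prod_empirical (x n) (hD n).1.2 a ha b hb).trans <| by
      rw [mul_assoc]
      exact mul_le_mul_of_nonneg_left (le_mul_of_mem_ratioClass hΔinf (hΔ n) a b) hK
  choose f hf hfD using fun n => (hD n).1.1
  choose F hFx hF using fun n => hΔinf.exists_coordinatewise_extension hKR
    (s := Set.range (x n)) (f := f n) fun a ha b hb => by
      rw [← hfD n]
      exact hfeas n a ha b hb
  have hFnorm (n : ℕ) (a b : M) : ‖F n a - F n b‖ ≤ √d * (K * R) * Δinf a b := by
    rw [mul_assoc]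
    exact norm_sub_le_of_coordinatewise (mul_nonneg hKR (hΔinf.nonneg a b)) fun j => hF n j a b
  have hFc (n : ℕ) : Continuous (F n) := hΔinf.continuous_of_norm_sub_le (hFnorm n)
  let m₀ : M := x 0 0
  -- The translation serves compactness only: `F n` itself must agree with `f n` on the sample, and
  -- both give the same distances.
  let G (n : ℕ) : C(M, EuclideanSpace ℝ (Fin d)) :=
    ⟨fun m => F n m - F n m₀, (hFc n).sub continuous_const⟩
  have hGF (n : ℕ) (a b : M) : G n a - G n b = F n a - F n b := sub_sub_sub_cancel_right _ _ _
  have hGlip (n : ℕ) (a b : M) : ‖G n a - G n b‖ ≤ √d * (K * R) * Δinf a b := by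
    rw [hGF]
    exact hFnorm n a b
  have hG₀ (n : ℕ) : G n m₀ = 0 := sub_self _
  let Dbar (n : ℕ) (a b : M) : ℝ := pairDist (G n) (a, b)
  have hrep (n : ℕ) : Represents (F n) (Dbar n) := fun a b => congrArg norm (hGF n a b)
  have hagree (n : ℕ) : ∀ a ∈ Set.range (x n), ∀ b ∈ Set.range (x n), Dbar n a b = D n a b :=
    fun a ha b hb => by rw [hrep, hfD, hFx n a ha, hFx n b hb]
  have hmin (n : ℕ) : Dbar n ∈ minimizers d K (Δ n) (empirical (x n)) :=
    minimizers_congr (range_mem_ae_empirical (x n)) (hD n)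
      (pairDist_mem_euclideanPseudometrics (G n)) (hagree n)
  have hsub (n : ℕ) := support_empirical_subset (x n)
  refine ⟨Dbar, fun n a ha b hb => hagree n a (hsub n ha) b (hsub n hb), hmin, ?_, ?_,
    ⟨f, F, fun n => ⟨hf n, hfD n, hrep n, fun m hm => hFx n m (hsub n hm), hF n⟩⟩, ?_, ?_⟩
  · obtain ⟨G', φ, hφ, hlim⟩ := hΔinf.exists_tendsto_subseq m₀ G hG₀ hGlip
    exact ⟨fun a b => pairDist G' (a, b), φ, hφ, ContinuousMap.tendsto_iff_tendstoUniformly.1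
      ((continuous_pairDist.tendsto G').comp hlim)⟩
  · rintro Dlim ⟨φ, hφ, hunif⟩
    -- Uniform convergence of the pseudometrics says nothing about the embeddings, so a further
    -- subsequence is extracted along which these converge too; uniqueness of limits identifies
    -- `Dlim`.
    obtain ⟨G', ψ, hψ, hlim⟩ := hΔinf.exists_tendsto_subseq m₀ (fun k => G (φ k))
      (fun k => hG₀ _) fun k => hGlip _
    have hDlim : Dlim = fun a b => pairDist G' (a, b) := by
      ext a b
      refine tendsto_nhds_unique ((hunif.tendsto_at (a, b)).comp hψ.tendsto_atTop) ?_
      exact ((continuous_eval_const (a, b)).tendsto _).comp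
        ((continuous_pairDist.tendsto G').comp hlim)
    obtain ⟨r, hr, hr1, hrΔ⟩ := exists_ratio_tendsto_one hΔinf hR hΔ hΔlim
    have hφψ : Tendsto (fun k => φ (ψ k)) atTop atTop :=
      hφ.tendsto_atTop.comp hψ.tendsto_atTop
    rw [hDlim]
    exact pairDist_mem_minimizers_of_tendsto hΔinf hK (hPlim.comp hφψ)
      (fun k => mem_of_superset (range_mem_ae_empirical _) (Set.range_subset_iff.2 (hx _)))
      (fun k => (hΔ _).2.1) (fun k => hr _) (hr1.comp hφψ) (fun k => hrΔ _) hlim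
      fun k => hmin _
  · obtain ⟨B, hB⟩ := hΔinf.exists_bound
    exact ⟨√d * (K * R) * B, fun n a b => (hGlip n a b).trans
      (mul_le_mul_of_nonneg_left (hB a b) (by positivity))⟩
  · intro n a b a' b'
    have hnorm : |Dbar n a b - Dbar n a' b'| ≤ ‖F n a - F n a'‖ + ‖F n b - F n b'‖ := by
      rw [hrep, hrep]
      refine (abs_norm_sub_norm_le _ _).trans ?_
      rw [sub_sub_sub_comm]
      exact norm_sub_le _ _
    -- Already `√2` would do here; `√3` matches the stated constant.
    have hsum : Δinf a a' + Δinf b b' ≤ √3 * √(Δinf a a' ^ 2 + Δinf b b' ^ 2) := by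
      rw [← Real.sqrt_mul zero_le_three]
      refine Real.le_sqrt_of_sq_le ?_
      nlinarith [sq_nonneg (Δinf a a' - Δinf b b'), sq_nonneg (Δinf a a'), sq_nonneg (Δinf b b')]
    calc |Dbar n a b - Dbar n a' b'|
        ≤ √d * (K * R) * Δinf a a' + √d * (K * R) * Δinf b b' :=
          hnorm.trans (add_le_add (hFnorm n a a') (hFnorm n b b'))
      _ = √d * (K * R) * (Δinf a a' + Δinf b b') := by ring
      _ ≤ √d * (K * R) * (√3 * √(Δinf a a' ^ 2 + Δinf b b' ^ 2)) :=
          mul_le_mul_of_nonneg_left hsum (by positivity)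
      _ = K * R * √(3 * d) * √(Δinf a a' ^ 2 + Δinf b b' ^ 2) := by
          rw [Real.sqrt_mul zero_le_three]
          ring
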